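/- Let $n\ge 1$, let $\mu$ be a Borel probability measure on $\mathbb R^n$ with finite second moment, $\int |x|^2\,d\mu(x)<\infty$, and let $s>0$. Let $X\sim\mu$ and let $Z$ be a standard Gaussian vector in $\mathbb R^n$ independent of $X$; put $$\mathrm{mmse}(\mu,s)=\mathbb E\,\bigl|X-\mathbb E[X\mid X+\sqrt s\,Z]\bigr|^2 .$$ Let the Poincaré constant $C_{\mathrm P}(\mu)\in[0,\infty]$ be the infimum of all real $C\ge 0$ such that $$\mathrm{Var}(f(X))\le C\cdot \mathbb E|\nabla f(X)|^2$$ for every locally Lipschitz function $f:\mathbb R^n\to\mathbb R$ that is differentiable $\mu$-almost everywhere (by Rademacher's theorem the latter is automatic if $\mu$ is absolutely continuous) and satisfies $\mathbb E|\nabla f(X)|^2<\infty$; here $\mathrm{Var}(f(X))=\infty$ if $f(X)$ is not square integrable, and $C_{\mathrm P}(\mu)=\infty$ if no such $C$ exists. Put $$P=\frac1n\,\mathbb E|X-\mathbb E X|^2,\qquad \bar C_{\mathrm P}(\mu)=\frac{C_{\mathrm P}(\mu)}{P}.$$ Then $$\mathrm{mmse}(\mu,s)\;\ge\;\frac{\mathbb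 E|X-\mathbb E X|^2}{1+\frac{C_{\mathrm P}(\mu)}{s}}\;=\;\frac{nP}{1+\frac{P}{s}\,\bar C_{\mathrm P}(\mu)},$$ where the two fractions are $0$ if $C_{\mathrm P}(\mu)=\infty$, and $\bar C_{\mathrm P}(\mu)$ is read as $0$ if $P=C_{\mathrm P}(\mu)=0$ (that is, if $X$ is almost surely constant). -/

import Mathlib

open MeasureTheory ProbabilityTheory
open scoped ENNReal NNReal

namespace GaussianChannel

noncomputable section

/-- `C` is admissible in the Poincaré inequality for `μ`: `Var f(X) ≤ C · E|∇f(X)|²` for `X ∼ μ` and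
every locally Lipschitz `f` with `E|∇f(X)|² < ∞`. For `∇f(X)` to be meaningful, `f` has to be
differentiable at `μ`-almost every point; by Rademacher's theorem this is automatic for every locally
Lipschitz `f` when `μ` is absolutely continuous. The variance takes values in `[0, ∞]`
(it is `∞` if `f(X)` is not square integrable). -/
def IsPoincareBound {n : ℕ} (μ : Measure (EuclideanSpace ℝ (Fin n))) (C : ℝ≥0) : Prop :=
  ∀ f : EuclideanSpace ℝ (Fin n) → ℝ, LocallyLipschitz f →
    (∀ᵐ x ∂μ, DifferentiableAt ℝ f x) →
    ∫⁻ x, ‖gradient f x‖ₑ ^ 2 ∂μ < ∞ →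
    evariance f μ ≤ C * ∫⁻ x, ‖gradient f x‖ₑ ^ 2 ∂μ

/-- The Poincaré constant `C_P(μ) ∈ [0, ∞]`: the infimum of all admissible finite `C ≥ 0`
(it is `∞` if there are none). -/
def poincareConstant {n : ℕ} (μ : Measure (EuclideanSpace ℝ (Fin n))) : ℝ≥0∞ :=
  ⨅ (C : ℝ≥0) (_ : IsPoincareBound μ C), (C : ℝ≥0∞)

/-- The total variance `E|X - E X|²` for `X ∼ μ`. -/
def totalVariance {n : ℕ} (μ : Measure (EuclideanSpace ℝ (Fin n))) : ℝ≥0∞ :=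
  ∫⁻ x, ‖x - ∫ y, y ∂μ‖ₑ ^ 2 ∂μ

/-- The variance per coordinate `P = (1/n) E|X - E X|²`. -/
def power {n : ℕ} (μ : Measure (EuclideanSpace ℝ (Fin n))) : ℝ≥0∞ :=
  totalVariance μ / n

/-- The normalized Poincaré constant `C_P(μ) / P`. -/
def normalizedPoincareConstant {n : ℕ} (μ : Measure (EuclideanSpace ℝ (Fin n))) : ℝ≥0∞ :=
  poincareConstant μ / power μ

/-- The joint law of `(X, Z)`: `X ∼ μ` and `Z` is a standard Gaussian vector independent of `X`. -/
def inputNoiseLaw {n : ℕ} (μ : Measure (EuclideanSpace ℝ (Fin n))) :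
    Measure (EuclideanSpace ℝ (Fin n) × EuclideanSpace ℝ (Fin n)) :=
  μ.prod (stdGaussian (EuclideanSpace ℝ (Fin n)))

/-- The channel output `X + √s Z`, as a function of the pair `(X, Z)`. -/
def output {n : ℕ} (s : ℝ) (p : EuclideanSpace ℝ (Fin n) × EuclideanSpace ℝ (Fin n)) :
    EuclideanSpace ℝ (Fin n) :=
  p.1 + Real.sqrt s • p.2

/-- The sigma-algebra generated by the channel output `X + √s Z`. -/
abbrev outputSigma (n : ℕ) (s : ℝ) :
    MeasurableSpace (EuclideanSpace ℝ (Fin n) × EuclideanSpace ℝ (Fin n)) :=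
  MeasurableSpace.comap (output s) inferInstance

/-- The minimum mean-square error `mmse(μ, s) = E|X - E[X | X + √s Z]|²`. -/
def mmse {n : ℕ} (μ : Measure (EuclideanSpace ℝ (Fin n))) (s : ℝ) : ℝ≥0∞ :=
  ∫⁻ p, ‖p.1 - ((inputNoiseLaw μ)[Prod.fst | outputSigma n s]) p‖ₑ ^ 2 ∂(inputNoiseLaw μ)

end

end GaussianChannel

/-!
Write `γ` for the standard Gaussian law, `Y = X + √s Z`, and for a bounded measurable function `g`
let `h(x) = E g(x + √s Z) = E[g(Y) | X = x]` be its Gaussian smoothing (`smoothing`).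

The Poincaré inequality for the law of `X` is applied to `h`, not to the conditional expectation
given `Y`. The Cameron–Martin formula (`map_add_stdGaussian_eq_tilted`) moves translations from `g`
to the Gaussian density, so `h` is differentiable although `g` is only measurable, and
`∇h(x) = E[g(x + √s Z) Z] / √s` (`hasGradientAt_smoothing`). Bessel's inequality in `L²(γ)` for the
projection of `z ↦ g(x + √s z)` onto the affine functions then gives the reverse Poincaré inequality
`s |∇h(x)|² ≤ E[g(Y)² | X = x] - h(x)²` (`mul_norm_gradient_smoothing_sq_le`). Integrated in `x` and
combined with the Poincaré inequality with constant `C`, this yields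
`s Var h(X) ≤ C (E g(Y)² - E h(X)²)`, that is `(C + s) Var h(X) ≤ C Var g(Y)`
(`mul_variance_smoothing_le`): conditioning on `X` contracts the variance of functions of `Y`.

By duality the same contraction limits how well `Y` predicts a square integrable `u(X)`. Since
`Cov(u(X), g(Y)) = Cov(u(X), h(X))`, the Cauchy–Schwarz inequality gives
`s Var u(X) ≤ (C + s) E(u(X) - g(Y))²` for bounded `g` (`mul_variance_le_of_bounded`), and truncation
removes the boundedness. Summing over the coordinates `u(x) = xᵢ` bounds the mean-square error of
every estimator `G(Y)` of `X`, in particular that of `E[X | Y]`, which is a measurable function of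
`Y`. Finally, the infimum defining the Poincaré constant is attained when it is finite
(`isPoincareBound_toNNReal_poincareConstant`), so `C` may be taken to be that constant.
-/

namespace GaussianChannel

open scoped RealInnerProductSpace

/-! ### The Cameron–Martin formula for the standard Gaussian measure -/

section Gaussian

variable {ι : Type*} [Fintype ι]

/-- The Laplace–Fourier transform of the standard Gaussian measure at the complex vector
`v + i t`. -/
lemma integral_cexp_inner_stdGaussian (v t : EuclideanSpace ℝ ι) :
    ∫ z, Complex.exp (((⟪v, z⟫ : ℝ) : ℂ) + ((⟪z, t⟫ : ℝ) : ℂ) * Complex.I)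
        ∂stdGaussian (EuclideanSpace ℝ ι) =
      Complex.exp (((‖v‖ ^ 2 / 2 : ℝ) : ℂ) + (((⟪v, t⟫ : ℝ) : ℂ) * Complex.I -
        ((‖t‖ ^ 2 / 2 : ℝ) : ℂ))) := by
  rw [← map_pi_eq_stdGaussian, integral_map (by fun_prop)
    (Measurable.aestronglyMeasurable (by fun_prop))]
  have h1 : ∀ x : ι → ℝ, Complex.exp (((⟪v, WithLp.toLp 2 x⟫ : ℝ) : ℂ) +
      ((⟪WithLp.toLp 2 x, t⟫ : ℝ) : ℂ) * Complex.I) =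
      ∏ i, Complex.exp (((v i : ℂ) + (t i : ℂ) * Complex.I) * x i) := by
    intro x
    rw [← Complex.exp_sum]
    congr 1
    simp only [PiLp.inner_apply, RCLike.inner_apply, conj_trivial, Complex.ofReal_sum,
      Complex.ofReal_mul, Finset.sum_mul, ← Finset.sum_add_distrib]
    exact Finset.sum_congr rfl fun i _ => by ring
  simp_rw [h1]
  rw [integral_fintype_prod_eq_prod
    (f := fun i (x : ℝ) => Complex.exp (((v i : ℂ) + (t i : ℂ) * Complex.I) * x))]
  have h2 : ∀ w : ℂ, ∫ x : ℝ, Complex.exp (w * x) ∂gaussianReal 0 1 = Complex.exp (w ^ 2 / 2) := by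
    intro w
    have := complexMGF_id_gaussianReal (μ := 0) (v := 1) (z := w)
    simpa [complexMGF] using this
  simp_rw [h2]
  rw [← Complex.exp_sum]
  congr 1
  simp only [EuclideanSpace.real_norm_sq_eq, PiLp.inner_apply, RCLike.inner_apply, conj_trivial]
  push_cast
  rw [Finset.sum_div, Finset.sum_div, Finset.sum_mul, ← Finset.sum_sub_distrib,
    ← Finset.sum_add_distrib]
  refine Finset.sum_congr rfl fun i _ => ?_
  ring_nf
  rw [Complex.I_sq]
  ring

lemma integrable_exp_mul_norm_stdGaussian (c : ℝ) :
    Integrable (fun z => Real.exp (c * ‖z‖)) (stdGaussian (EuclideanSpace ℝ ι)) := by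
  -- Fernique's theorem, with `c r ≤ c² / (4 C) + C r²`.
  obtain ⟨C, hC, hint⟩ := IsGaussian.exists_integrable_exp_sq (stdGaussian (EuclideanSpace ℝ ι))
  refine Integrable.mono' (hint.const_mul (Real.exp (c ^ 2 / (4 * C)))) (by fun_prop) ?_
  refine .of_forall fun z => ?_
  rw [Real.norm_eq_abs, Real.abs_exp, ← Real.exp_add]
  gcongr
  have : 0 ≤ (2 * C * ‖z‖ - c) ^ 2 / (4 * C) := by positivity
  have h2 : (2 * C * ‖z‖ - c) ^ 2 / (4 * C) = c ^ 2 / (4 * C) + C * ‖z‖ ^ 2 - c * ‖z‖ := by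
    field_simp
    ring
  linarith

lemma integral_exp_inner_stdGaussian (v : EuclideanSpace ℝ ι) :
    ∫ z, Real.exp ⟪v, z⟫ ∂stdGaussian (EuclideanSpace ℝ ι) = Real.exp (‖v‖ ^ 2 / 2) := by
  have h := integral_cexp_inner_stdGaussian v 0
  simp only [inner_zero_right, Complex.ofReal_zero, zero_mul, add_zero, norm_zero, ne_eq,
    OfNat.ofNat_ne_zero, not_false_eq_true, zero_pow, zero_div, sub_zero,
    ← Complex.ofReal_exp] at h
  rw [integral_complex_ofReal] at h
  exact_mod_cast h

/-- The **Cameron–Martin formula**: the standard Gaussian measure translated by `v` is its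
exponential tilting by `z ↦ ⟪v, z⟫`. -/
lemma map_add_stdGaussian_eq_tilted (v : EuclideanSpace ℝ ι) :
    (stdGaussian (EuclideanSpace ℝ ι)).map (fun z => z + v) =
      (stdGaussian (EuclideanSpace ℝ ι)).tilted (fun z => ⟪v, z⟫) := by
  have : IsProbabilityMeasure ((stdGaussian (EuclideanSpace ℝ ι)).map (fun z => z + v)) :=
    Measure.isProbabilityMeasure_map (by fun_prop)
  apply Measure.ext_of_charFun
  ext t
  rw [charFun_map_add_const, charFun_stdGaussian, charFun_apply, integral_tilted]
  have h : ∀ z : EuclideanSpace ℝ ι, (Real.exp ⟪v, z⟫ /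
      ∫ z, Real.exp ⟪v, z⟫ ∂stdGaussian (EuclideanSpace ℝ ι)) •
        Complex.exp (⟪z, t⟫ * Complex.I) = Complex.exp (-((‖v‖ ^ 2 / 2 : ℝ) : ℂ)) *
        Complex.exp (((⟪v, z⟫ : ℝ) : ℂ) + ((⟪z, t⟫ : ℝ) : ℂ) * Complex.I) := by
    intro z
    rw [integral_exp_inner_stdGaussian, ← Real.exp_sub, Complex.real_smul, Complex.ofReal_exp,
      ← Complex.exp_add, ← Complex.exp_add]
    congr 1
    push_cast
    ring
  simp_rw [h]
  rw [integral_const_mul, integral_cexp_inner_stdGaussian, ← Complex.exp_add, ← Complex.exp_add]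
  congr 1
  push_cast
  ring

lemma integral_comp_add_stdGaussian {f : EuclideanSpace ℝ ι → ℝ} (hf : Measurable f)
    (v : EuclideanSpace ℝ ι) :
    ∫ z, f (z + v) ∂stdGaussian (EuclideanSpace ℝ ι) =
      ∫ z, f z * Real.exp (⟪v, z⟫ - ‖v‖ ^ 2 / 2) ∂stdGaussian (EuclideanSpace ℝ ι) := by
  rw [← integral_map (φ := fun z => z + v) (by fun_prop) hf.aestronglyMeasurable,
    map_add_stdGaussian_eq_tilted, integral_tilted]
  refine integral_congr_ae (.of_forall fun z => ?_)
  simp only [integral_exp_inner_stdGaussian, Real.exp_sub, smul_eq_mul]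
  ring

lemma hasFDerivAt_exp_inner_sub (z v : EuclideanSpace ℝ ι) (c : ℝ) :
    HasFDerivAt (fun v : EuclideanSpace ℝ ι => c * Real.exp (⟪v, z⟫ - ‖v‖ ^ 2 / 2))
      ((c * Real.exp (⟪v, z⟫ - ‖v‖ ^ 2 / 2)) • innerSL ℝ (z - v)) v := by
  have h1 : HasFDerivAt (fun v : EuclideanSpace ℝ ι => ⟪v, z⟫) (innerSL ℝ z) v := by
    have := (innerSL ℝ z).hasFDerivAt (x := v)
    refine this.congr_of_eventuallyEq (.of_forall fun w => ?_)
    simp [real_inner_comm]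
  have h2 : HasFDerivAt (fun v : EuclideanSpace ℝ ι => ‖v‖ ^ 2) (2 • innerSL ℝ v) v :=
    (hasStrictFDerivAt_norm_sq v).hasFDerivAt
  have h3 := ((h1.sub (h2.mul_const (2⁻¹ : ℝ))).exp).const_mul c
  refine HasFDerivAt.congr_fderiv (h3.congr_of_eventuallyEq (.of_forall fun w => ?_)) ?_
  · simp [div_eq_mul_inv]
  · ext w
    simp [div_eq_mul_inv]
    ring

/-- Gaussian integration by parts, for a function that is only bounded and measurable: by the
Cameron–Martin formula the derivative falls on the density `exp (⟪v, z⟫ - ‖v‖ ^ 2 / 2)`. -/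
lemma hasGradientAt_integral_comp_add_stdGaussian {f : EuclideanSpace ℝ ι → ℝ} (hf : Measurable f)
    {M : ℝ} (hM : ∀ z, |f z| ≤ M) :
    HasGradientAt (fun v => ∫ z, f (z + v) ∂stdGaussian (EuclideanSpace ℝ ι))
      (∫ z, f z • z ∂stdGaussian (EuclideanSpace ℝ ι)) 0 := by
  have hM0 : 0 ≤ M := (abs_nonneg _).trans (hM 0)
  have hexp : ∀ v ∈ Metric.ball (0 : EuclideanSpace ℝ ι) 1, ∀ z : EuclideanSpace ℝ ι,
      Real.exp (⟪v, z⟫ - ‖v‖ ^ 2 / 2) ≤ Real.exp ‖z‖ := by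
    intro v hv z
    rw [mem_ball_zero_iff] at hv
    gcongr
    have h1 := real_inner_le_norm v z
    nlinarith [norm_nonneg v, norm_nonneg z, sq_nonneg ‖v‖]
  have key : HasFDerivAt (fun v => ∫ z, f z * Real.exp (⟪v, z⟫ - ‖v‖ ^ 2 / 2)
        ∂stdGaussian (EuclideanSpace ℝ ι))
      (∫ z, (f z * Real.exp (⟪(0 : EuclideanSpace ℝ ι), z⟫ - ‖(0 : EuclideanSpace ℝ ι)‖ ^ 2 / 2)) •
        innerSL ℝ (z - 0) ∂stdGaussian (EuclideanSpace ℝ ι)) 0 := by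
    refine hasFDerivAt_integral_of_dominated_of_fderiv_le
      (F' := fun v z => (f z * Real.exp (⟪v, z⟫ - ‖v‖ ^ 2 / 2)) • innerSL ℝ (z - v))
      (bound := fun z => M * Real.exp (2 * ‖z‖)) (Metric.ball_mem_nhds _ one_pos)
      (.of_forall fun v => Measurable.aestronglyMeasurable (by fun_prop)) ?_
      ?_ ?_ ((integrable_exp_mul_norm_stdGaussian 2).const_mul M) ?_
    · refine Integrable.mono' (integrable_const M) (Measurable.aestronglyMeasurable (by fun_prop))
        (.of_forall fun z => ?_)
      simpa using hM z
    · exact Measurable.aestronglyMeasurable (by fun_prop)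
    · refine .of_forall fun z v hv => ?_
      have h1 := hexp v hv z
      rw [mem_ball_zero_iff] at hv
      have h2 : ‖z - v‖ ≤ Real.exp ‖z‖ :=
        (norm_sub_le z v).trans (by linarith [Real.add_one_le_exp ‖z‖])
      rw [norm_smul, norm_mul, Real.norm_eq_abs, Real.norm_eq_abs, Real.abs_exp,
        innerSL_apply_norm, two_mul, Real.exp_add, ← mul_assoc]
      gcongr
      exact hM z
    · exact .of_forall fun z v _ => hasFDerivAt_exp_inner_sub z v (f z)
  simp_rw [integral_comp_add_stdGaussian hf]
  rw [hasGradientAt_iff_hasFDerivAt]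
  refine key.congr_fderiv ?_
  have hint : Integrable (fun z => f z • z) (stdGaussian (EuclideanSpace ℝ ι)) :=
    IsGaussian.integrable_id.bdd_smul M hf.aestronglyMeasurable (.of_forall hM)
  simp only [inner_zero_left, norm_zero, ne_eq, OfNat.ofNat_ne_zero, not_false_eq_true, zero_pow,
    zero_div, sub_zero, Real.exp_zero, mul_one]
  have := (innerSL ℝ (E := EuclideanSpace ℝ ι)).integral_comp_comm hint
  simp only [map_smul] at this
  rw [this]
  rfl

/-! ### Gaussian smoothing of a bounded measurable function -/

/-- The Gaussian smoothing `x ↦ E g(x + √s Z)` with `Z` standard Gaussian. This is the conditional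
expectation of `g (X + √s Z)` given `X = x`. -/
noncomputable def smoothing (s : ℝ) (g : EuclideanSpace ℝ ι → ℝ) (x : EuclideanSpace ℝ ι) : ℝ :=
  ∫ z, g (x + Real.sqrt s • z) ∂stdGaussian (EuclideanSpace ℝ ι)

variable {s : ℝ} {g : EuclideanSpace ℝ ι → ℝ} {M : ℝ}

lemma hasGradientAt_smoothing (hs : 0 < s) (hg : Measurable g) (hM : ∀ y, |g y| ≤ M)
    (x : EuclideanSpace ℝ ι) :
    HasGradientAt (smoothing s g)
      ((Real.sqrt s)⁻¹ • ∫ z, g (x + Real.sqrt s • z) • z ∂stdGaussian (EuclideanSpace ℝ ι)) x := by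
  have hs0 : Real.sqrt s ≠ 0 := (Real.sqrt_pos.2 hs).ne'
  have h1 := hasGradientAt_integral_comp_add_stdGaussian
    (f := fun z => g (x + Real.sqrt s • z)) (by fun_prop) (fun z => hM _)
  have h2 : HasFDerivAt (fun y : EuclideanSpace ℝ ι => (Real.sqrt s)⁻¹ • (y - x))
      ((Real.sqrt s)⁻¹ • ContinuousLinearMap.id ℝ (EuclideanSpace ℝ ι)) x :=
    ((hasFDerivAt_id x).sub_const x).const_smul ((Real.sqrt s)⁻¹)
  rw [hasGradientAt_iff_hasFDerivAt] at h1 ⊢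
  have h0 : (Real.sqrt s)⁻¹ • (x - x) = 0 := by simp
  rw [← h0] at h1
  refine ((h1.comp x h2).congr_of_eventuallyEq (.of_forall fun y => ?_)).congr_fderiv ?_
  · simp only [smoothing, Function.comp_apply]
    congr 1 with z
    congr 1
    rw [smul_add, smul_smul, mul_inv_cancel₀ hs0, one_smul]
    abel
  · ext w
    simp

/-- The reverse Poincaré inequality: `s |∇h(x)|² ≤ Var g(x + √s Z)` for the smoothing `h` of `g`. -/
lemma mul_norm_gradient_smoothing_sq_le (hs : 0 < s) (hg : Measurable g) (hM : ∀ y, |g y| ≤ M)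
    (x : EuclideanSpace ℝ ι) :
    s * ‖gradient (smoothing s g) x‖ ^ 2 ≤
      smoothing s (fun y => g y ^ 2) x - smoothing s g x ^ 2 := by
  rw [(hasGradientAt_smoothing hs hg hM x).gradient]
  have hs0 : Real.sqrt s ≠ 0 := (Real.sqrt_pos.2 hs).ne'
  set γ := stdGaussian (EuclideanSpace ℝ ι)
  set f : EuclideanSpace ℝ ι → ℝ := fun z => g (x + Real.sqrt s • z) with hf
  have hfm : Measurable f := by fun_prop
  have hfM : ∀ z, |f z| ≤ M := fun z => hM _
  set w := (∫ z, f z • z ∂γ) with hw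
  have hid : Integrable (fun z => z) γ := IsGaussian.integrable_id
  have hint : Integrable (fun z => f z • z) γ :=
    hid.bdd_smul M hfm.aestronglyMeasurable (.of_forall hfM)
  have hL2 : MemLp (fun z => ⟪w, z⟫) 2 γ := IsGaussian.memLp_two_id.const_inner w
  have hf2 : MemLp f 2 γ := MemLp.of_bound hfm.aestronglyMeasurable M (.of_forall hfM)
  have e1 : ∫ z, ⟪w, z⟫ ∂γ = 0 := by
    rw [integral_inner hid, integral_id_stdGaussian, inner_zero_right]
  have e2 : ∫ z, ⟪w, z⟫ ^ 2 ∂γ = ‖w‖ ^ 2 := by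
    have h := variance_dual_stdGaussian (innerSL ℝ w)
    rw [variance_of_integral_eq_zero (by fun_prop) (by simpa using e1)] at h
    simpa using h
  have e3 : ∫ z, f z * ⟪w, z⟫ ∂γ = ‖w‖ ^ 2 := by
    have h : ‖w‖ ^ 2 = ⟪w, ∫ z, f z • z ∂γ⟫ := (real_inner_self_eq_norm_sq w).symm
    rw [h, ← integral_inner hint]
    simp_rw [inner_smul_right]
  -- With `w = E[f(Z) Z]`, the squared residual of `f` after subtracting its mean and `⟪w, z⟫`.
  have hnonneg : 0 ≤ ∫ z, (f z - (∫ z, f z ∂γ) - ⟪w, z⟫) ^ 2 ∂γ :=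
    integral_nonneg fun z => sq_nonneg _
  set m := ∫ z, f z ∂γ with hm
  have hexpand : ∀ z, (f z - m - ⟪w, z⟫) ^ 2 =
      f z ^ 2 + (⟪w, z⟫ ^ 2 + (m ^ 2 + ((2 * m) * ⟪w, z⟫ - ((2 * m) * f z +
        2 * (f z * ⟪w, z⟫))))) := fun z => by ring
  have i1 := hf2.integrable_sq
  have i2 := hL2.integrable_sq
  have i3 := hf2.integrable one_le_two
  have i4 := hL2.integrable one_le_two
  have i5 : Integrable (fun z => f z * ⟪w, z⟫) γ := hf2.integrable_mul hL2
  simp_rw [hexpand] at hnonneg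
  rw [integral_add i1 (by fun_prop), integral_add i2 (by fun_prop),
    integral_add (by fun_prop) (by fun_prop), integral_sub (by fun_prop) (by fun_prop),
    integral_add (by fun_prop) (by fun_prop)] at hnonneg
  simp only [integral_const_mul, e1, e2, e3, integral_const, probReal_univ, one_smul, ← hm]
    at hnonneg
  have e4 : smoothing s (fun y => g y ^ 2) x = ∫ z, f z ^ 2 ∂γ := rfl
  have e5 : smoothing s g x = m := rfl
  rw [e4, e5, norm_smul, mul_pow, norm_inv, Real.norm_eq_abs, inv_pow, sq_abs, Real.sq_sqrt hs.le,
    ← mul_assoc, mul_inv_cancel₀ hs.ne', one_mul]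
  linarith

lemma abs_smoothing_le (hM : ∀ y, |g y| ≤ M) (x : EuclideanSpace ℝ ι) : |smoothing s g x| ≤ M := by
  have := norm_integral_le_of_norm_le_const (μ := stdGaussian (EuclideanSpace ℝ ι))
    (f := fun z => g (x + Real.sqrt s • z)) (C := M) (.of_forall fun z => hM (x + Real.sqrt s • z))
  simpa [smoothing] using this

lemma norm_gradient_smoothing_le (hs : 0 < s) (hg : Measurable g) (hM : ∀ y, |g y| ≤ M)
    (x : EuclideanSpace ℝ ι) : ‖gradient (smoothing s g) x‖ ≤ M / Real.sqrt s := by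
  have hM0 : 0 ≤ M := (abs_nonneg _).trans (hM 0)
  have h1 := mul_norm_gradient_smoothing_sq_le hs hg hM x
  have h2 : smoothing s (fun y => g y ^ 2) x ≤ M ^ 2 :=
    (le_abs_self _).trans (abs_smoothing_le (fun y => by
      rw [abs_pow]; exact pow_le_pow_left₀ (abs_nonneg _) (hM y) 2) x)
  refine le_of_sq_le_sq ?_ (by positivity)
  rw [div_pow, Real.sq_sqrt hs.le, le_div_iff₀ hs]
  nlinarith [sq_nonneg (smoothing s g x)]

lemma lipschitzWith_smoothing (hs : 0 < s) (hg : Measurable g) (hM : ∀ y, |g y| ≤ M) :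
    LipschitzWith (M / Real.sqrt s).toNNReal (smoothing s g) := by
  refine lipschitzWith_of_nnnorm_fderiv_le (𝕜 := ℝ)
    (fun x => (hasGradientAt_smoothing hs hg hM x).differentiableAt) fun x => ?_
  have h := norm_gradient_smoothing_le hs hg hM x
  rw [gradient, LinearIsometryEquiv.norm_map] at h
  rw [← NNReal.coe_le_coe]
  exact h.trans (Real.le_coe_toNNReal _)

end Gaussian

/-! ### Estimation from the channel output -/

section Channel

variable {n : ℕ} {μ : Measure (EuclideanSpace ℝ (Fin n))} {s : ℝ}
  {g : EuclideanSpace ℝ (Fin n) → ℝ} {M : ℝ}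

lemma sq_covariance_le {Ω : Type*} [MeasurableSpace Ω] {ν : Measure Ω} [IsFiniteMeasure ν]
    {X Y : Ω → ℝ} (hX : MemLp X 2 ν) (hY : MemLp Y 2 ν) :
    cov[X, Y; ν] ^ 2 ≤ Var[X; ν] * Var[Y; ν] := by
  have h : ∀ x : ℝ, 0 ≤ Var[X; ν] * (x * x) + 2 * cov[X, Y; ν] * x + Var[Y; ν] := fun x => by
    have h0 := variance_nonneg (x • X + Y) ν
    rw [variance_add (hX.const_smul x) hY, variance_smul, covariance_smul_left] at h0
    linarith
  have := discrim_le_zero h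
  rw [discrim] at this
  linarith

lemma measurable_output : Measurable (output (n := n) s) := by
  unfold output
  fun_prop

lemma integrable_mul_comp_output {u : EuclideanSpace ℝ (Fin n) → ℝ} (hu : Integrable u μ)
    (hg : Measurable g) (hM : ∀ y, |g y| ≤ M) :
    Integrable (fun p => u p.1 * g (output s p)) (inputNoiseLaw μ) := by
  have h : Integrable (fun p : EuclideanSpace ℝ (Fin n) × EuclideanSpace ℝ (Fin n) => u p.1)
      (inputNoiseLaw μ) := hu.comp_fst _
  exact h.mul_bdd (c := M) (hg.comp measurable_output).aestronglyMeasurable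
    (.of_forall fun p => hM _)

variable [IsProbabilityMeasure μ]

instance : IsProbabilityMeasure (inputNoiseLaw μ) := by
  unfold inputNoiseLaw
  infer_instance

/-- The tower property: `E[u(X) g(X + √s Z)] = E[u(X) h(X)]` for the smoothing `h` of `g`. -/
lemma integral_mul_comp_output {u : EuclideanSpace ℝ (Fin n) → ℝ} (hu : Integrable u μ)
    (hg : Measurable g) (hM : ∀ y, |g y| ≤ M) :
    ∫ p, u p.1 * g (output s p) ∂inputNoiseLaw μ = ∫ x, u x * smoothing s g x ∂μ := by
  have h := integrable_mul_comp_output (s := s) hu hg hM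
  rw [inputNoiseLaw] at h ⊢
  rw [integral_prod _ h]
  simp_rw [integral_const_mul]
  rfl

lemma memLp_smoothing (hs : 0 < s) (hg : Measurable g) (hM : ∀ y, |g y| ≤ M) :
    MemLp (smoothing s g) 2 μ :=
  MemLp.of_bound (lipschitzWith_smoothing hs hg hM).continuous.measurable.aestronglyMeasurable M
    (.of_forall (abs_smoothing_le hM))

/-- The Poincaré inequality for the smoothing of `g`, with its energy bounded by the mean conditional
variance of `g (X + √s Z)` given `X`. -/
lemma mul_variance_smoothing_le {C : ℝ≥0} (hC : IsPoincareBound μ C) (hs : 0 < s)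
    (hg : Measurable g) (hM : ∀ y, |g y| ≤ M) :
    s * Var[smoothing s g; μ] ≤
      C * (∫ p, g (output s p) ^ 2 ∂inputNoiseLaw μ - ∫ x, smoothing s g x ^ 2 ∂μ) := by
  have hgrad := hasGradientAt_smoothing hs hg hM
  have hg2 : ∀ y, |g y ^ 2| ≤ M ^ 2 := fun y => by
    rw [abs_pow]
    exact pow_le_pow_left₀ (abs_nonneg _) (hM y) 2
  have hL2 : MemLp (smoothing s g) 2 μ := memLp_smoothing hs hg hM
  have hA : ∫ p, g (output s p) ^ 2 ∂inputNoiseLaw μ =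
      ∫ x, smoothing s (fun y => g y ^ 2) x ∂μ := by
    simpa using integral_mul_comp_output (s := s) (μ := μ) (integrable_const (1 : ℝ))
      (hg.pow_const 2) hg2
  have hi1 : Integrable (smoothing s (fun y => g y ^ 2)) μ :=
    (memLp_smoothing hs (hg.pow_const 2) hg2).integrable one_le_two
  have hi : Integrable
      (fun x => (smoothing s (fun y => g y ^ 2) x - smoothing s g x ^ 2) / s) μ :=
    (hi1.sub hL2.integrable_sq).div_const s
  have hpt : ∀ x, ‖gradient (smoothing s g) x‖ ^ 2 ≤
      (smoothing s (fun y => g y ^ 2) x - smoothing s g x ^ 2) / s := fun x => by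
    rw [le_div_iff₀ hs, mul_comm]
    exact mul_norm_gradient_smoothing_sq_le hs hg hM x
  have henergy : ∫⁻ x, ‖gradient (smoothing s g) x‖ₑ ^ 2 ∂μ ≤ ENNReal.ofReal
      (∫ x, (smoothing s (fun y => g y ^ 2) x - smoothing s g x ^ 2) / s ∂μ) := by
    rw [ofReal_integral_eq_lintegral_ofReal hi
      (.of_forall fun x => (sq_nonneg _).trans (hpt x))]
    refine lintegral_mono fun x => ?_
    rw [← ofReal_norm, ← ENNReal.ofReal_pow (norm_nonneg _)]
    exact ENNReal.ofReal_le_ofReal (hpt x)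
  have h := hC _ (lipschitzWith_smoothing hs hg hM).locallyLipschitz
    (.of_forall fun x => (hgrad x).differentiableAt) (henergy.trans_lt ENNReal.ofReal_lt_top)
  rw [← hL2.ofReal_variance_eq] at h
  have h2 := h.trans (mul_le_mul_right henergy (C : ℝ≥0∞))
  rw [← ENNReal.ofReal_coe_nnreal, ← ENNReal.ofReal_mul C.coe_nonneg,
    ENNReal.ofReal_le_ofReal_iff (mul_nonneg C.coe_nonneg
      (integral_nonneg fun x => (sq_nonneg _).trans (hpt x))), integral_div,
    integral_sub hi1 hL2.integrable_sq, ← hA, ← mul_div_assoc, le_div_iff₀ hs] at h2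
  linarith

/-- A lower bound for the mean-square error of a bounded estimator `g (X + √s Z)` of `u X`. -/
lemma mul_variance_le_of_bounded {C : ℝ≥0} (hC : IsPoincareBound μ C) (hs : 0 < s)
    {u : EuclideanSpace ℝ (Fin n) → ℝ} (hu : MemLp u 2 μ)
    (hg : Measurable g) (hM : ∀ y, |g y| ≤ M) :
    s * Var[u; μ] ≤ (C + s) * ∫ p, (u p.1 - g (output s p)) ^ 2 ∂inputNoiseLaw μ := by
  have hP := mul_variance_smoothing_le hC hs hg hM
  have hh : MemLp (smoothing s g) 2 μ := memLp_smoothing hs hg hM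
  have hGm : Measurable (fun p => g (output (n := n) s p)) := hg.comp measurable_output
  have hG : MemLp (fun p => g (output s p)) 2 (inputNoiseLaw μ) :=
    MemLp.of_bound hGm.aestronglyMeasurable M (.of_forall fun p => hM _)
  have hu1 : Integrable u μ := hu.integrable one_le_two
  have hU : MemLp (fun p : EuclideanSpace ℝ (Fin n) × EuclideanSpace ℝ (Fin n) => u p.1) 2
      (inputNoiseLaw μ) := hu.comp_fst _
  have hUint : ∫ p, u p.1 ^ 2 ∂inputNoiseLaw μ = ∫ x, u x ^ 2 ∂μ := by
    rw [inputNoiseLaw, integral_fun_fst (fun x => u x ^ 2)]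
    simp
  have hexp : ∫ p, (u p.1 - g (output s p)) ^ 2 ∂inputNoiseLaw μ =
      ∫ x, u x ^ 2 ∂μ - 2 * ∫ x, u x * smoothing s g x ∂μ +
        ∫ p, g (output s p) ^ 2 ∂inputNoiseLaw μ := by
    have i := integrable_mul_comp_output (s := s) hu1 hg hM
    have hpt : ∀ p : EuclideanSpace ℝ (Fin n) × EuclideanSpace ℝ (Fin n),
        (u p.1 - g (output s p)) ^ 2 =
          u p.1 ^ 2 + (g (output s p) ^ 2 - 2 * (u p.1 * g (output s p))) := fun p => by ring
    have i2 : Integrable (fun p => g (output s p) ^ 2 - 2 * (u p.1 * g (output s p)))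
        (inputNoiseLaw μ) := hG.integrable_sq.sub (i.const_mul 2)
    simp_rw [hpt]
    rw [integral_add hU.integrable_sq i2,
      integral_sub hG.integrable_sq (i.const_mul 2), integral_const_mul,
      integral_mul_comp_output hu1 hg hM, hUint]
    ring
  have hcov := covariance_eq_sub hu hh
  have hcs : cov[u, smoothing s g; μ] ^ 2 ≤ Var[u; μ] * Var[smoothing s g; μ] :=
    sq_covariance_le hu hh
  have hGmean : ∫ p, g (output s p) ∂inputNoiseLaw μ = ∫ x, smoothing s g x ∂μ := by
    simpa using integral_mul_comp_output (s := s) (μ := μ) (integrable_const (1 : ℝ)) hg hM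
  have hVG := variance_nonneg (fun p => g (output s p)) (inputNoiseLaw μ)
  rw [variance_eq_sub hG, hGmean] at hVG
  have hVu := variance_eq_sub hu
  have hVh := variance_eq_sub hh
  have hVu0 := variance_nonneg u μ
  have hVh0 := variance_nonneg (smoothing s g) μ
  simp only [Pi.pow_apply, Pi.mul_apply] at hcov hVu hVh hVG
  rw [hexp]
  set V := Var[u; μ]
  set B := Var[smoothing s g; μ]
  set t := cov[u, smoothing s g; μ]
  set A := ∫ p, g (output s p) ^ 2 ∂inputNoiseLaw μ
  set a := ∫ x, u x ∂μ
  set m := ∫ x, smoothing s g x ∂μ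
  have e1 : ∫ x, u x ^ 2 ∂μ = V + a ^ 2 := by linarith
  have e2 : ∫ x, u x * smoothing s g x ∂μ = t + a * m := by linarith
  have e3 : ∫ x, smoothing s g x ^ 2 ∂μ = B + m ^ 2 := by linarith
  rw [e1, e2]
  rw [e3] at hP
  have hC0 : (0 : ℝ) ≤ C := C.coe_nonneg
  generalize (C : ℝ) = c at *
  have hcs0 : 0 < c + s := by positivity
  -- `q` is the variance of `g (X + √s Z)`
  obtain ⟨q, hq⟩ : ∃ q, A = q + m ^ 2 := ⟨A - m ^ 2, by ring⟩
  rw [hq] at hP ⊢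
  have hB : (c + s) * B ≤ c * q := by linarith
  have hq0 : 0 ≤ (c + s) * q := mul_nonneg hcs0.le (by linarith)
  -- `(c + s)² t² ≤ (c V) ((c + s) q)`, followed by the inequality of arithmetic and geometric means
  have hmain : 2 * ((c + s) * t) ≤ c * V + (c + s) * q := by
    refine abs_le_of_sq_le_sq' ?_ (by positivity) |>.2
    have h1 : ((c + s) * t) ^ 2 ≤ (c + s) * (V * (c * q)) := by
      calc ((c + s) * t) ^ 2 = (c + s) ^ 2 * t ^ 2 := by ring
        _ ≤ (c + s) ^ 2 * (V * B) := by gcongr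
        _ = (c + s) * (V * ((c + s) * B)) := by ring
        _ ≤ (c + s) * (V * (c * q)) := by gcongr
    nlinarith [sq_nonneg (c * V - (c + s) * q)]
  nlinarith [mul_nonneg hcs0.le (sq_nonneg (a - m))]

/-- `mul_variance_le_of_bounded` without boundedness, by truncating `g` at the levels `±k`. -/
lemma mul_variance_le_of_memLp {C : ℝ≥0} (hC : IsPoincareBound μ C) (hs : 0 < s)
    {u : EuclideanSpace ℝ (Fin n) → ℝ} (hu : MemLp u 2 μ)
    (hg : Measurable g) (hG : MemLp (fun p => g (output s p)) 2 (inputNoiseLaw μ)) :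
    s * Var[u; μ] ≤ (C + s) * ∫ p, (u p.1 - g (output s p)) ^ 2 ∂inputNoiseLaw μ := by
  have hU : MemLp (fun p : EuclideanSpace ℝ (Fin n) × EuclideanSpace ℝ (Fin n) => u p.1) 2
      (inputNoiseLaw μ) := hu.comp_fst _
  let T : ℕ → ℝ → ℝ := fun k y => max (-(k : ℝ)) (min k y)
  have hTm : ∀ k, Measurable (T k) := fun k => by fun_prop
  have hTk : ∀ k y, |T k y| ≤ k := fun k y => by
    have : (0 : ℝ) ≤ k := k.cast_nonneg
    exact abs_le.2 ⟨le_max_left _ _, max_le (by linarith) (min_le_left _ _)⟩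
  have hTy : ∀ k y, |T k y| ≤ |y| := fun k y => by
    have : (0 : ℝ) ≤ k := k.cast_nonneg
    refine abs_le.2 ⟨le_max_of_le_right (le_min ?_ (neg_abs_le y)),
      max_le ?_ ((min_le_right _ _).trans (le_abs_self y))⟩ <;> linarith [abs_nonneg y]
  have hTeq : ∀ y, ∀ᶠ k in Filter.atTop, T k y = y := fun y => by
    filter_upwards [Filter.eventually_ge_atTop ⌈|y|⌉₊] with k hk
    have := abs_le.1 (Nat.ceil_le.1 hk)
    simp only [T]
    rw [min_eq_right this.2, max_eq_right this.1]
  have hGm : ∀ k, Measurable (fun p => T k (g (output (n := n) s p))) := fun k =>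
    (hTm k).comp (hg.comp measurable_output)
  have hlim : Filter.Tendsto
      (fun k => ∫ p, (u p.1 - T k (g (output s p))) ^ 2 ∂inputNoiseLaw μ) Filter.atTop
      (nhds (∫ p, (u p.1 - g (output s p)) ^ 2 ∂inputNoiseLaw μ)) := by
    refine tendsto_integral_of_dominated_convergence
      (fun p => 2 * u p.1 ^ 2 + 2 * g (output s p) ^ 2)
      (fun k => (hU.aestronglyMeasurable.sub (hGm k).aestronglyMeasurable).pow 2)
      ((hU.integrable_sq.const_mul 2).add (hG.integrable_sq.const_mul 2))
      (fun k => .of_forall fun p => ?_) (.of_forall fun p => ?_)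
    · rw [Real.norm_eq_abs, abs_of_nonneg (sq_nonneg _)]
      have h := sq_le_sq.2 (hTy k (g (output s p)))
      nlinarith [sq_nonneg (u p.1 + T k (g (output s p)))]
    · refine tendsto_const_nhds.congr' ?_
      filter_upwards [hTeq (g (output s p))] with k hk
      rw [hk]
  exact ge_of_tendsto (hlim.const_mul _)
    (.of_forall fun k => mul_variance_le_of_bounded hC hs hu ((hTm k).comp hg) (fun y => hTk k _))

lemma evariance_le_mul_lintegral {C : ℝ≥0} (hC : IsPoincareBound μ C) (hs : 0 < s)
    {u : EuclideanSpace ℝ (Fin n) → ℝ} (hu : MemLp u 2 μ) (hg : Measurable g) :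
    evariance u μ ≤ (1 + C / ENNReal.ofReal s) *
      ∫⁻ p, ‖u p.1 - g (output s p)‖ₑ ^ 2 ∂inputNoiseLaw μ := by
  have hU : MemLp (fun p : EuclideanSpace ℝ (Fin n) × EuclideanSpace ℝ (Fin n) => u p.1) 2
      (inputNoiseLaw μ) := hu.comp_fst _
  have hGm : Measurable (fun p => g (output (n := n) s p)) := hg.comp measurable_output
  -- If the error is finite then `g (X + √s Z)` is square integrable, because `u X` is.
  by_cases hfin : ∫⁻ p, ‖u p.1 - g (output s p)‖ₑ ^ 2 ∂inputNoiseLaw μ = ∞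
  · rw [hfin, ENNReal.mul_top (by simp)]
    exact le_top
  have hD : MemLp (fun p => u p.1 - g (output s p)) 2 (inputNoiseLaw μ) := by
    refine ⟨hU.aestronglyMeasurable.sub hGm.aestronglyMeasurable, ?_⟩
    rw [eLpNorm_lt_top_iff_lintegral_rpow_enorm_lt_top two_ne_zero ENNReal.ofNat_ne_top]
    simpa using Ne.lt_top hfin
  have hG : MemLp (fun p => g (output s p)) 2 (inputNoiseLaw μ) :=
    (hU.sub hD).ae_eq (.of_forall fun p => sub_sub_cancel _ _)
  have h := mul_variance_le_of_memLp hC hs hu hg hG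
  have hint : ∫⁻ p, ‖u p.1 - g (output s p)‖ₑ ^ 2 ∂inputNoiseLaw μ =
      ENNReal.ofReal (∫ p, (u p.1 - g (output s p)) ^ 2 ∂inputNoiseLaw μ) := by
    rw [ofReal_integral_eq_lintegral_ofReal hD.integrable_sq (.of_forall fun p => sq_nonneg _)]
    refine lintegral_congr fun p => ?_
    rw [← ofReal_norm, ← ENNReal.ofReal_pow (norm_nonneg _), Real.norm_eq_abs, sq_abs]
  rw [hint, ← hu.ofReal_variance_eq, ← ENNReal.ofReal_coe_nnreal, ← ENNReal.ofReal_div_of_pos hs,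
    ← ENNReal.ofReal_one, ← ENNReal.ofReal_add zero_le_one (by positivity),
    ← ENNReal.ofReal_mul (by positivity)]
  refine ENNReal.ofReal_le_ofReal ?_
  rw [← mul_le_mul_iff_right₀ hs]
  refine h.trans_eq ?_
  field_simp
  ring

/-- The infimum defining the Poincaré constant is attained when it is finite. -/
lemma isPoincareBound_toNNReal_poincareConstant {μ : Measure (EuclideanSpace ℝ (Fin n))}
    (h : poincareConstant μ ≠ ∞) :
    IsPoincareBound μ (poincareConstant μ).toNNReal := by
  intro f hf hd hfin
  rw [ENNReal.coe_toNNReal h, ← ENNReal.div_le_iff_le_mul (.inr h) (.inl hfin.ne)]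
  refine le_iInf₂ fun C hC => ?_
  rw [ENNReal.div_le_iff_le_mul (.inr ENNReal.coe_ne_top) (.inl hfin.ne)]
  exact hC f hf hd hfin

lemma enorm_sq_eq_sum_enorm_sq {ι : Type*} [Fintype ι] (x : EuclideanSpace ℝ ι) :
    ‖x‖ₑ ^ 2 = ∑ i, ‖x i‖ₑ ^ 2 := by
  simp_rw [← ofReal_norm, ← ENNReal.ofReal_pow (norm_nonneg _)]
  rw [EuclideanSpace.norm_sq_eq, ENNReal.ofReal_sum_of_nonneg fun i _ => sq_nonneg _]

lemma totalVariance_eq_sum_evariance {μ : Measure (EuclideanSpace ℝ (Fin n))}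
    (hμ : Integrable (fun x => x) μ) :
    totalVariance μ = ∑ i, evariance (fun x => x i) μ := by
  have hmean : ∀ i, (∫ y, y ∂μ) i = ∫ y, y i ∂μ := fun i =>
    ((EuclideanSpace.proj (𝕜 := ℝ) i).integral_comp_comm hμ).symm
  simp only [totalVariance, evariance, enorm_sq_eq_sum_enorm_sq, PiLp.sub_apply, hmean]
  exact lintegral_finsetSum _ fun i _ => by fun_prop

lemma totalVariance_le_mul_lintegral {C : ℝ≥0} (hC : IsPoincareBound μ C) (hs : 0 < s)
    (hμ : MemLp (fun x => x) 2 μ)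
    {G : EuclideanSpace ℝ (Fin n) → EuclideanSpace ℝ (Fin n)} (hG : Measurable G) :
    totalVariance μ ≤ (1 + C / ENNReal.ofReal s) *
      ∫⁻ p, ‖p.1 - G (output s p)‖ₑ ^ 2 ∂inputNoiseLaw μ := by
  have hGi : ∀ i, Measurable (fun y => G y i) := fun i =>
    (EuclideanSpace.proj (𝕜 := ℝ) i).measurable.comp hG
  have hm : ∀ i, Measurable (fun p : EuclideanSpace ℝ (Fin n) × EuclideanSpace ℝ (Fin n) =>
      ‖p.1 i - G (output s p) i‖ₑ ^ 2) := fun i =>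
    ((((EuclideanSpace.proj (𝕜 := ℝ) i).measurable.comp measurable_fst).sub
      ((hGi i).comp measurable_output)).enorm).pow_const 2
  rw [totalVariance_eq_sum_evariance (hμ.integrable one_le_two)]
  simp only [enorm_sq_eq_sum_enorm_sq, PiLp.sub_apply]
  rw [lintegral_finsetSum _ fun i _ => hm i, Finset.mul_sum]
  refine Finset.sum_le_sum fun i _ => ?_
  have hu : MemLp (fun x : EuclideanSpace ℝ (Fin n) => x i) 2 μ :=
    (EuclideanSpace.proj (𝕜 := ℝ) i).comp_memLp' hμ
  exact evariance_le_mul_lintegral (g := fun y => G y i) hC hs hu (hGi i)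

lemma totalVariance_le_mul_mmse (hs : 0 < s) (hμ : MemLp (fun x => x) 2 μ)
    (h : poincareConstant μ ≠ ∞) :
    totalVariance μ ≤ (1 + poincareConstant μ / ENNReal.ofReal s) * mmse μ s := by
  obtain ⟨G, hG, hfac⟩ := (stronglyMeasurable_condExp (μ := inputNoiseLaw μ)
    (m := outputSigma n s) (f := Prod.fst)).measurable.exists_eq_measurable_comp
  have := totalVariance_le_mul_lintegral (isPoincareBound_toNNReal_poincareConstant h) hs hμ hG
  rw [ENNReal.coe_toNNReal h] at this
  -- Only the measurability of the conditional expectation with respect to the output matters.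
  rw [mmse, hfac]
  exact this

lemma totalVariance_ne_top (hμ : MemLp (fun x => x) 2 μ) : totalVariance μ ≠ ∞ := by
  have h := (hμ.sub (memLp_const (∫ y, y ∂μ))).2
  rw [eLpNorm_lt_top_iff_lintegral_rpow_enorm_lt_top two_ne_zero ENNReal.ofNat_ne_top] at h
  simpa [totalVariance] using h.ne

/-- For `n = 0` both sides vanish. -/
lemma natCast_mul_power (μ : Measure (EuclideanSpace ℝ (Fin n))) :
    n * power μ = totalVariance μ := by
  rcases Nat.eq_zero_or_pos n with rfl | hn
  · have h : ∀ x : EuclideanSpace ℝ (Fin 0), x = 0 := fun x => Subsingleton.elim _ _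
    simp [totalVariance, h]
  · exact ENNReal.mul_div_cancel (by exact_mod_cast hn.ne') (ENNReal.natCast_ne_top n)

lemma totalVariance_div_eq (hμ : MemLp (fun x => x) 2 μ) (s : ℝ) :
    totalVariance μ / (1 + poincareConstant μ / ENNReal.ofReal s) =
      n * power μ / (1 + power μ / ENNReal.ofReal s * normalizedPoincareConstant μ) := by
  rw [natCast_mul_power]
  -- If `X` is almost surely constant, both numerators vanish; otherwise `0 < power μ < ∞` cancels.
  by_cases hV : totalVariance μ = 0
  · simp [hV]
  have hP0 : power μ ≠ 0 := fun h0 => hV (by rw [← natCast_mul_power, h0, mul_zero])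
  have hn : n ≠ 0 := by
    rintro rfl
    exact hV (by rw [← natCast_mul_power]; simp)
  have hPtop : power μ ≠ ∞ :=
    ENNReal.div_ne_top (totalVariance_ne_top hμ) (by exact_mod_cast hn)
  congr 2
  rw [normalizedPoincareConstant, div_eq_mul_inv (power μ), mul_right_comm,
    ENNReal.mul_div_cancel hP0 hPtop, div_eq_mul_inv]

end Channel

end GaussianChannel

theorem mainTheorem3 (n : ℕ) (μ : Measure (EuclideanSpace ℝ (Fin n))) [IsProbabilityMeasure μ]
    (hμ : MemLp (fun x : EuclideanSpace ℝ (Fin n) => x) 2 μ) (s : ℝ) (hs : 0 < s) :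
    GaussianChannel.totalVariance μ /
        (1 + GaussianChannel.poincareConstant μ / ENNReal.ofReal s) ≤ GaussianChannel.mmse μ s ∧
    GaussianChannel.totalVariance μ /
        (1 + GaussianChannel.poincareConstant μ / ENNReal.ofReal s) =
      n * GaussianChannel.power μ /
        (1 + GaussianChannel.power μ / ENNReal.ofReal s *
          GaussianChannel.normalizedPoincareConstant μ) := by
  refine ⟨?_, GaussianChannel.totalVariance_div_eq hμ s⟩
  by_cases h : GaussianChannel.poincareConstant μ = ∞
  · simp [h, ENNReal.top_div]
  · exact ENNReal.div_le_of_le_mul' (GaussianChannel.totalVariance_le_mul_mmse hs hμ h)
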